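/- Let $0<p<1$ and $q=1-p$. Let $\mathsf{BS}(p)$ denote the standardized Bernoulli distribution, which has mass $p$ at $\sqrt{q/p}$ and mass $q$ at $-\sqrt{p/q}$. Put $$m_*(p)=\frac{1+p+2p^2}{2\left(\sqrt{p-p^2}+2p^2\right)}\quad\text{if } 0<p\le\tfrac12,\qquad m_*(p)=1\quad\text{if }\tfrac12\le p<1,$$ and let $\mathcal F$ be the class of all twice continuously differentiable functions $f\colon\mathbb R\to\mathbb R$ such that $f$ and $f''$ are nondecreasing and convex. For a real number $m>0$, a natural number $n\ge1$ and nonnegative real numbers $c_1,\dots,c_n$ put $$s^{(m)}=\left(\frac1n\sum_{i=1}^n c_i^{2m}\right)^{1/(2m)}.$$ Then the following holds. 1. For every real $m\ge m_*(p)$, every $f\in\mathcal F$, every natural $n\ge1$, all real $c_1,\dots,c_n\ge0$, and all independent random variables $\mathrm{BS}_1,\dots,\mathrm{BS}_n$, each with the distribution $\mathsf{BS}(p)$, $$\mathsf E f(c_1\mathrm{BS}_1+\dots+c_n\mathrm{BS}_n)\le\mathsf E f\left(s^{(m)}\,(\mathrm{BS}_1+\dots+\mathrm{BS}_n)\right).$$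 2. The lower bound $m_*(p)$ on $m$ is exact: for every real $m$ with $0<m<m_*(p)$ there are $f\in\mathcal F$, $n\ge1$, $c_1,\dots,c_n\ge0$ and independent random variables $\mathrm{BS}_1,\dots,\mathrm{BS}_n$, each with the distribution $\mathsf{BS}(p)$, for which this inequality fails. -/

import Mathlib

open MeasureTheory ProbabilityTheory

/-- The standardized Bernoulli distribution `BS(p)` for `0 < p < 1`: with `q = 1 - p`, it gives
mass `p` to the point `√(q/p)` and mass `q` to the point `-√(p/q)`. -/
noncomputable def stdBernoulli (p : ℝ) (hp : p ∈ Set.Ioo (0 : ℝ) 1) : Measure ℝ :=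
  bernoulliMeasure (√((1 - p) / p)) (-√(p / (1 - p))) ⟨p, hp.1.le, hp.2.le⟩

/-- The class `F³₊` of all twice continuously differentiable functions `f : ℝ → ℝ` such that `f`
and its second derivative are nondecreasing and convex. -/
def classF3 : Set (ℝ → ℝ) :=
  {f | ContDiff ℝ 2 f ∧ Monotone f ∧ ConvexOn ℝ Set.univ f ∧
    Monotone (iteratedDeriv 2 f) ∧ ConvexOn ℝ Set.univ (iteratedDeriv 2 f)}

/-- The threshold `m_*(p)`; both defining expressions have the value `1` at `p = 1/2`. -/
noncomputable def mStar (p : ℝ) : ℝ :=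
  if p ≤ 1 / 2 then (1 + p + 2 * p ^ 2) / (2 * (√(p - p ^ 2) + 2 * p ^ 2)) else 1

/-- `s^{(m)}`, the power mean of order `2m` of the numbers `c₁, …, cₙ`. -/
noncomputable def powerMean {n : ℕ} (m : ℝ) (c : Fin n → ℝ) : ℝ :=
  (1 / (n : ℝ) * ∑ i, c i ^ (2 * m)) ^ (1 / (2 * m))

/-- The family `X₁, …, Xₙ` is independent, and each `Xᵢ` has the distribution `BS(p)`. -/
structure IsIIDStdBernoulli {Ω : Type*} [MeasurableSpace Ω] {n : ℕ} (p : ℝ)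
    (hp : p ∈ Set.Ioo (0 : ℝ) 1) (X : Fin n → Ω → ℝ) (P : Measure Ω) : Prop where
  indep : iIndepFun X P
  hasLaw : ∀ i, HasLaw (X i) (stdBernoulli p hp) P

/-! In the variables `cᵢ ^ (2m)` the claim is of Schur type: at fixed sum, bringing two of these
variables closer together does not decrease the expectation. Averaging over the other summands keeps
`f` in `classF3`, so two summands suffice (`bernAvg_bernAvg_antitoneOn`), and finitely many such
transfers make all variables equal (`bernAvgs_le_replicate`).

For a pair `M ± τ`, the sign of the derivative in `τ` is a four-point inequality for `g = f'` with
the factor `(a / b) ^ κ`, `κ = 2m - 1` (`four_point`). The function `h = f''` is nonnegative,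
nondecreasing and convex, so it lies below a chord between the chord's ends and above it outside.
The worst case is therefore a truncated affine `h`, that is, a cubic `(x - t)₊³` for `f`, and a
quadratic inequality in the position of the kink remains (`two_point_inner`). For `p ≤ 1/2` a
hyperbolic substitution gives the best constant, which is at most `a ^ κ - 1` once `κ ≥ 1 / (p + √(p
- p²)) = 2 m_* - 1`; for `p > 1/2` already `κ ≥ 1` is enough.

Exactness uses the same cubics. If `m < 1`, a kink far to the left makes the variance decisive, and
it drops when `(1, 0)` is replaced by its power means. If `p < 1/2` and `m < m_*`, the weights `1 ±
ε` and the worst kink violate the inequality at order `ε²`. -/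

/-! ### Hyperbolic estimates and the scalar inequality -/

theorem sinh_mul_le_mul_sinh {θ y : ℝ} (h0 : 0 ≤ θ) (h1 : θ ≤ 1) (hy : 0 ≤ y) :
    Real.sinh (θ * y) ≤ θ * Real.sinh y := by
  have hd : ∀ x, HasDerivAt (fun x => θ * Real.sinh x - Real.sinh (θ * x))
      (θ * (Real.cosh x - Real.cosh (θ * x))) x := by
    intro x
    have h2 : HasDerivAt (fun x => θ * x) θ x := by
      simpa using (hasDerivAt_id x).const_mul θ
    exact (((Real.hasDerivAt_sinh x).const_mul θ).sub h2.sinh).congr_deriv (by ring)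
  have hmono : MonotoneOn (fun x => θ * Real.sinh x - Real.sinh (θ * x)) (Set.Ici 0) := by
    refine monotoneOn_of_deriv_nonneg (convex_Ici 0)
      (fun x _ => (hd x).continuousAt.continuousWithinAt)
      (fun x _ => (hd x).differentiableAt.differentiableWithinAt) ?_
    intro x hx
    rw [interior_Ici] at hx
    rw [(hd x).deriv]
    have hx' : 0 ≤ x := le_of_lt hx
    have : Real.cosh (θ * x) ≤ Real.cosh x := by
      rw [Real.cosh_le_cosh, abs_of_nonneg (mul_nonneg h0 hx'), abs_of_nonneg hx']
      exact mul_le_of_le_one_left hx' h1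
    exact mul_nonneg h0 (sub_nonneg.2 this)
  have := hmono (Set.mem_Ici.2 le_rfl) (Set.mem_Ici.2 hy) hy
  simpa using this

/-- With `d = (1 + θ) y`, clearing denominators turns this into `sinh (θ y) ≤ θ sinh y`. -/
theorem add_exp_le_mul_exp {θ d : ℝ} (h0 : 0 < θ) (h1 : θ ≤ 1) (hd : 0 ≤ d) :
    θ + Real.exp d ≤ (1 + θ * Real.exp d) * Real.exp (d * (1 - θ) / (1 + θ)) := by
  set y := d / (1 + θ) with hy
  have hθ : 0 < 1 + θ := by linarith
  have hdy : d = (1 + θ) * y := by rw [hy]; field_simp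
  have e1 : d * (1 - θ) / (1 + θ) = y - θ * y := by rw [hdy]; field_simp
  have key := sinh_mul_le_mul_sinh h0.le h1 (div_nonneg hd hθ.le : 0 ≤ y)
  rw [Real.sinh_eq, Real.sinh_eq] at key
  have e2 : d = y + θ * y := by rw [hdy]; ring
  rw [e1, e2, sub_eq_add_neg, Real.exp_add, Real.exp_add]
  rw [Real.exp_neg, Real.exp_neg] at key
  rw [Real.exp_neg]
  set P := Real.exp y
  set Q := Real.exp (θ * y)
  have hP : 0 < P := Real.exp_pos _
  have hQ : 0 < Q := Real.exp_pos _
  have := mul_le_mul_of_nonneg_left key hP.le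
  have e3 : P * ((Q - Q⁻¹) / 2) = (P * Q - P * Q⁻¹) / 2 := by ring
  have e4 : P * (θ * ((P - P⁻¹) / 2)) = (θ * P ^ 2 - θ) / 2 := by field_simp
  have e5 : (1 + θ * (P * Q)) * (P * Q⁻¹) = P * Q⁻¹ + θ * P ^ 2 := by field_simp
  rw [e3, e4] at this
  rw [e5]
  linarith

/-- Take `A = exp η` and `E = exp ζ` with `a = exp (2η)` and `θ sinh ζ = sinh η`. Then `η ≤ ζ ≤ η /
θ`, and `add_exp_le_mul_exp` at `d = ζ - η` bounds the quotient by `exp (2η + 2(ζ - η) / (1 + θ))`.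
At the largest possible `ζ` this exponent is `2η (1 + θ²) / (θ (1 + θ))`, whence the condition on
`κ`. -/
theorem exists_hyperbolic_bound {θ a κ : ℝ} (h0 : 0 < θ) (h1 : θ ≤ 1) (ha : 1 ≤ a)
    (hκ : (1 + θ ^ 2) / (θ * (1 + θ)) ≤ κ) :
    ∃ A E : ℝ, 0 < A ∧ 0 < E ∧ a = A ^ 2 ∧ θ * A * (E ^ 2 - 1) = (A ^ 2 - 1) * E ∧
      A * E * (θ * A + E) / (θ * E + A) ≤ a ^ κ := by
  set η := Real.log a / 2 with hη
  have hη0 : 0 ≤ η := by have := Real.log_nonneg ha; positivity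
  set ζ := Real.arsinh (Real.sinh η / θ) with hζ
  have hs : θ * Real.sinh ζ = Real.sinh η := by
    rw [hζ, Real.sinh_arsinh]; field_simp
  have hsη : 0 ≤ Real.sinh η := Real.sinh_nonneg_iff.2 hη0
  have hηζ : η ≤ ζ := by
    rw [← Real.sinh_le_sinh]
    have : 0 ≤ Real.sinh ζ := by
      by_contra! hcon
      nlinarith
    nlinarith
  have hζ' : ζ ≤ η / θ := by
    rw [← Real.sinh_le_sinh]
    have := sinh_mul_le_mul_sinh h0.le h1 (div_nonneg hη0 h0.le : 0 ≤ η / θ)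
    rw [mul_div_cancel₀ _ h0.ne', ← hs] at this
    exact le_of_mul_le_mul_left this h0
  have hrel := hs
  rw [Real.sinh_eq, Real.sinh_eq, Real.exp_neg, Real.exp_neg] at hrel
  have haη : a = Real.exp (2 * η) := by
    rw [hη, mul_div_cancel₀ _ two_ne_zero, Real.exp_log (by linarith)]
  refine ⟨Real.exp η, Real.exp ζ, Real.exp_pos _, Real.exp_pos _, ?_, ?_, ?_⟩
  · rw [haη, ← Real.exp_nat_mul]; norm_num
  · have hA := Real.exp_pos η
    have hE := Real.exp_pos ζ
    field_simp at hrel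
    linarith
  · have hd0 : 0 ≤ ζ - η := by linarith
    have key := add_exp_le_mul_exp h0 h1 hd0
    have hrw : Real.exp ζ = Real.exp η * Real.exp (ζ - η) := by
      rw [← Real.exp_add]; congr 1; ring
    rw [haη, ← Real.exp_mul, hrw]
    set A := Real.exp η with hA
    set D := Real.exp (ζ - η) with hD
    have hApos : 0 < A := Real.exp_pos _
    have hDpos : 0 < D := Real.exp_pos _
    have e1 : A * (A * D) * (θ * A + A * D) / (θ * (A * D) + A)
        = A * A * D * ((θ + D) / (1 + θ * D)) := by
      field_simp
      ring
    rw [e1]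
    have e2 : (θ + D) / (1 + θ * D) ≤ Real.exp ((ζ - η) * (1 - θ) / (1 + θ)) := by
      rw [div_le_iff₀ (by positivity)]; linarith
    calc A * A * D * ((θ + D) / (1 + θ * D))
        ≤ A * A * D * Real.exp ((ζ - η) * (1 - θ) / (1 + θ)) := by gcongr
      _ = Real.exp (η + η + (ζ - η) + (ζ - η) * (1 - θ) / (1 + θ)) := by
          rw [Real.exp_add, Real.exp_add, Real.exp_add]
      _ ≤ Real.exp (2 * η * κ) := by
          rw [Real.exp_le_exp]
          have e3 : η + η + (ζ - η) + (ζ - η) * (1 - θ) / (1 + θ)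
              = 2 * η + (ζ - η) * (2 / (1 + θ)) := by field_simp; ring
          have e4 : 2 * η + (η / θ - η) * (2 / (1 + θ))
              = 2 * η * ((1 + θ ^ 2) / (θ * (1 + θ))) := by field_simp; ring
          rw [e3]
          calc 2 * η + (ζ - η) * (2 / (1 + θ)) ≤ 2 * η + (η / θ - η) * (2 / (1 + θ)) := by
                gcongr
            _ = _ := e4
            _ ≤ _ := by gcongr

/-- If `a ^ κ - 1` is replaced by the smaller constant `K` built from `A` and `E`, the difference of
the two sides is `K (u - θ A / E)²`. The relation between `A` and `E` is exactly the condition for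
this double root. -/
theorem quadratic_le_rpow_sub_one_mul {θ a κ u : ℝ} (h0 : 0 < θ) (h1 : θ ≤ 1) (ha : 1 ≤ a)
    (hκ : (1 + θ ^ 2) / (θ * (1 + θ)) ≤ κ) (hu : 0 ≤ u) :
    (1 + θ ^ 2) * ((a - 1) ^ 2 + 2 * (a - 1) * u) ≤
      (a ^ κ - 1) * (θ ^ 2 * (1 + 2 * (a - 1) + 2 * u) + u ^ 2) := by
  obtain ⟨A, E, hA, hE, haA, hrel, hle⟩ := exists_hyperbolic_bound h0 h1 ha hκ
  have hW : 0 ≤ θ ^ 2 * (1 + 2 * (a - 1) + 2 * u) + u ^ 2 := by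
    have : 0 ≤ a - 1 := by linarith
    positivity
  refine le_trans ?_ (mul_le_mul_of_nonneg_right (sub_le_sub_right hle 1) hW)
  set K := A * E * (θ * A + E) / (θ * E + A) - 1 with hK
  have hden : 0 < θ * E + A := by positivity
  have hKe : K * (θ * E + A) = A * E * (θ * A + E) - (θ * E + A) := by
    rw [hK]; field_simp
  have hKc : K * θ * (θ * E + A) = (1 + θ ^ 2) * (A ^ 2 - 1) * E := by
    linear_combination θ * hKe + hrel
  have hsq : E ^ 2 * θ * (1 + (A ^ 2 - 1)) - (A ^ 2 - 1) * A * E - θ * A ^ 2 = 0 := by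
    linear_combination A * hrel
  have hident : E ^ 2 * (K * (θ ^ 2 * (1 + 2 * (A ^ 2 - 1) + 2 * u) + u ^ 2)
      - (1 + θ ^ 2) * ((A ^ 2 - 1) ^ 2 + 2 * (A ^ 2 - 1) * u)) = K * (u * E - θ * A) ^ 2 := by
    linear_combination ((A ^ 2 - 1) + 2 * u) * E * hKc + K * θ * hsq
  have hA1 : 1 ≤ A ^ 2 := haA ▸ ha
  have hK0 : 0 ≤ K := by
    have h2 : 0 ≤ K * (θ * (θ * E + A)) := by
      rw [← mul_assoc, hKc]
      have : 0 ≤ A ^ 2 - 1 := by linarith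
      positivity
    exact nonneg_of_mul_nonneg_left h2 (by positivity)
  have h3 : 0 ≤ E ^ 2 * (K * (θ ^ 2 * (1 + 2 * (A ^ 2 - 1) + 2 * u) + u ^ 2)
      - (1 + θ ^ 2) * ((A ^ 2 - 1) ^ 2 + 2 * (A ^ 2 - 1) * u)) := by
    rw [hident]; positivity
  have h4 := nonneg_of_mul_nonneg_right h3 (by positivity)
  rw [haA]
  linarith

/-- The threshold in the form in which it enters the proof, as a bound on the exponent `2m - 1`. -/
theorem mStar_eq_of_le_half {p : ℝ} (hp : 0 < p) (h : p ≤ 1 / 2) :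
    2 * mStar p - 1 = 1 / (p + √(p - p ^ 2)) := by
  have h1 : 0 < p - p ^ 2 := by nlinarith
  have hr := Real.sq_sqrt h1.le
  have hr0 := Real.sqrt_pos.2 h1
  rw [mStar, if_pos h]
  set r := √(p - p ^ 2)
  field_simp
  linear_combination -hr

theorem one_le_mStar {p : ℝ} (hp : 0 < p) : 1 ≤ mStar p := by
  by_cases h : p ≤ 1 / 2
  · have h2 := mStar_eq_of_le_half hp h
    have h1 : 0 ≤ p - p ^ 2 := by nlinarith
    have hr : √(p - p ^ 2) ≤ 1 / 2 := by
      rw [Real.sqrt_le_left (by norm_num)]; nlinarith [sq_nonneg (p - 1 / 2)]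
    have h3 : 0 ≤ √(p - p ^ 2) := Real.sqrt_nonneg _
    have : 1 ≤ 1 / (p + √(p - p ^ 2)) := by
      rw [le_div_iff₀ (by linarith)]; linarith
    linarith
  · rw [mStar, if_neg h]

theorem sub_one_le_rpow_sub_one {a κ : ℝ} (ha : 1 ≤ a) (hκ : 1 ≤ κ) : a - 1 ≤ a ^ κ - 1 := by
  have := Real.rpow_le_rpow_of_exponent_le ha hκ
  rw [Real.rpow_one] at this
  linarith

theorem two_point_inner {p m a u : ℝ} (hp : p ∈ Set.Ioo (0 : ℝ) 1) (hm : mStar p ≤ m)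
    (ha : 1 ≤ a) (hu : 0 ≤ u) :
    (a - 1) ^ 2 + 2 * (a - 1) * u ≤
      (a ^ (2 * m - 1) - 1) * (p * (1 + 2 * (a - 1) + 2 * u) + (1 - p) * u ^ 2) := by
  obtain ⟨hp0, hp1⟩ := hp
  have hs : 0 ≤ a - 1 := by linarith
  by_cases h : p ≤ 1 / 2
  · have hq : 0 < 1 - p := by linarith
    -- In terms of `θ` the threshold `1 / (p + √(p - p²))` is `(1 + θ²) / (θ (1 + θ))`.
    set θ := √(p / (1 - p)) with hθ
    have hθ2 : θ ^ 2 = p / (1 - p) := Real.sq_sqrt (by positivity)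
    have hθ0 : 0 < θ := Real.sqrt_pos.2 (by positivity)
    have hθ1 : θ ≤ 1 := by
      rw [hθ, Real.sqrt_le_one, div_le_one hq]; linarith
    have hpθ : p = θ ^ 2 / (1 + θ ^ 2) := by rw [hθ2]; field_simp; ring
    have hr : √(p - p ^ 2) = θ / (1 + θ ^ 2) := by
      rw [Real.sqrt_eq_iff_mul_self_eq_of_pos (by positivity), hpθ]; field_simp; ring
    have hκ : (1 + θ ^ 2) / (θ * (1 + θ)) ≤ 2 * m - 1 := by
      have := mStar_eq_of_le_half hp0 h
      have e : 1 / (p + √(p - p ^ 2)) = (1 + θ ^ 2) / (θ * (1 + θ)) := by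
        rw [hr]; nth_rewrite 1 [hpθ]; field_simp; ring
      linarith
    have key := quadratic_le_rpow_sub_one_mul hθ0 hθ1 ha hκ hu
    have h2 : p * (1 + 2 * (a - 1) + 2 * u) + (1 - p) * u ^ 2 =
        (θ ^ 2 * (1 + 2 * (a - 1) + 2 * u) + u ^ 2) / (1 + θ ^ 2) := by
      rw [hpθ]; field_simp; ring
    rw [h2, mul_div_assoc', le_div_iff₀ (by positivity)]
    linarith
  · have hm1 := one_le_mStar hp0
    have hK := sub_one_le_rpow_sub_one ha (by linarith : 1 ≤ 2 * m - 1)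
    have hW : 0 ≤ p * (1 + 2 * (a - 1) + 2 * u) + (1 - p) * u ^ 2 := by
      have : 0 < 1 - p := by linarith
      positivity
    refine le_trans ?_ (mul_le_mul_of_nonneg_right hK hW)
    -- The expression equals `(2p - 1) a + (1 - p)(1 - u)²`.
    have : 0 ≤ p * (1 + 2 * (a - 1) + 2 * u) + (1 - p) * u ^ 2 - ((a - 1) + 2 * u) := by
      nlinarith [mul_nonneg (by linarith : 0 ≤ 2 * p - 1) hs, sq_nonneg (1 - u)]
    nlinarith

/-- Both sides are affine in `u`. The case `u = 1` is `two_point_inner`, and the slopes compare as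
`2(a - 1) ≤ 2(a ^ (2m - 1) - 1)`. -/
theorem two_point_outer {p m a u : ℝ} (hp : p ∈ Set.Ioo (0 : ℝ) 1) (hm : mStar p ≤ m)
    (ha : 1 ≤ a) (hu1 : 1 ≤ u) :
    (a - 1) ^ 2 + 2 * (a - 1) * u ≤
      (a ^ (2 * m - 1) - 1) * (p * (1 + 2 * (a - 1) + 2 * u) + (1 - p) * (2 * u - 1)) := by
  have hm1 := one_le_mStar hp.1
  have hK := sub_one_le_rpow_sub_one ha (by linarith : 1 ≤ 2 * m - 1)
  have h1 := two_point_inner hp hm ha zero_le_one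
  nlinarith [mul_nonneg (by linarith : 0 ≤ u - 1)
    (by linarith : 0 ≤ (a ^ (2 * m - 1) - 1) - (a - 1))]

/-! ### The four-point inequality -/

theorem quadratic_le_sub_of_affine_le_deriv {g h : ℝ → ℝ} {y σ x₀ x₁ : ℝ}
    (hg : ∀ x, HasDerivAt g (h x) x) (hx : x₀ ≤ x₁)
    (hle : ∀ x ∈ Set.Icc x₀ x₁, y + σ * (x - 1) ≤ h x) :
    y * (x₁ - x₀) + σ * ((x₁ - 1) ^ 2 - (x₀ - 1) ^ 2) / 2 ≤ g x₁ - g x₀ := by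
  have hd : ∀ x, HasDerivAt (fun x => g x - (y * x + σ * (x - 1) ^ 2 / 2))
      (h x - (y + σ * (x - 1))) x := by
    intro x
    have h1 : HasDerivAt (fun x : ℝ => (x - 1) ^ 2) (2 * (x - 1)) x := by
      simpa using ((hasDerivAt_id x).sub_const 1).fun_pow 2
    have h2 : HasDerivAt (fun x : ℝ => y * x) y x := by
      simpa using (hasDerivAt_id x).const_mul y
    exact ((hg x).sub (h2.add ((h1.const_mul σ).div_const 2))).congr_deriv (by ring)
  have hmono : MonotoneOn (fun x => g x - (y * x + σ * (x - 1) ^ 2 / 2)) (Set.Icc x₀ x₁) := by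
    refine monotoneOn_of_deriv_nonneg (convex_Icc x₀ x₁)
      (fun x _ => (hd x).continuousAt.continuousWithinAt)
      (fun x _ => (hd x).differentiableAt.differentiableWithinAt) ?_
    intro x hx
    rw [(hd x).deriv]
    have := hle x (interior_subset hx)
    linarith
  have := hmono (Set.left_mem_Icc.2 hx) (Set.right_mem_Icc.2 hx) hx
  simp only at this
  linarith

theorem ConvexOn.mul_sub_le_mul_sub {h : ℝ → ℝ} (hc : ConvexOn ℝ Set.univ h) {x y z : ℝ}
    (hxy : x ≤ y) (hyz : y ≤ z) : (h y - h x) * (z - y) ≤ (h z - h y) * (y - x) := by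
  rcases hxy.eq_or_lt with rfl | hxy
  · simp
  rcases hyz.eq_or_lt with rfl | hyz
  · simp
  have := hc.slope_mono_adjacent (Set.mem_univ x) (Set.mem_univ z) hxy hyz
  rw [div_le_div_iff₀ (by linarith) (by linarith)] at this
  linarith

/-- The four-point inequality for a function whose derivative is nonnegative, nondecreasing and
convex. -/
theorem four_point_unit {g h : ℝ → ℝ} {p m a : ℝ} (hg : ∀ x, HasDerivAt g (h x) x)
    (hmono : Monotone h) (hconv : ConvexOn ℝ Set.univ h) (hnn : ∀ x, 0 ≤ h x)
    (hp : p ∈ Set.Ioo (0 : ℝ) 1) (hm : mStar p ≤ m) (ha : 1 ≤ a) :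
    g a - g 1 ≤ (a ^ (2 * m - 1) - 1) *
      (p * (g (a + 1) - g a) + (1 - p) * (g 1 - g 0)) := by
  rcases ha.eq_or_lt with rfl | ha'
  · simp
  have hK := sub_one_le_rpow_sub_one ha (by linarith [one_le_mStar hp.1] : 1 ≤ 2 * m - 1)
  obtain ⟨hp0, hp1⟩ := id hp
  have hs : 0 < a - 1 := by linarith
  obtain ⟨y, hy⟩ : ∃ y, h 1 = y := ⟨_, rfl⟩
  -- `σ` is the slope of the chord of `h` over `[1, a]`. By convexity `h` is below this chord on
  -- `[1, a]` and above it on both sides; integration bounds the increments of `g`.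
  obtain ⟨σ, hσe⟩ : ∃ σ, σ * (a - 1) = h a - y := ⟨(h a - y) / (a - 1), by field_simp⟩
  have hσ0 : 0 ≤ σ := by
    refine nonneg_of_mul_nonneg_left ?_ hs
    rw [hσe, ← hy]; exact sub_nonneg.2 (hmono ha)
  have hy0 : 0 ≤ y := hy ▸ hnn 1
  have hmid : ∀ x ∈ Set.Icc 1 a, -y + (-σ) * (x - 1) ≤ -h x := by
    rintro x ⟨h1, h2⟩
    have := hconv.mul_sub_le_mul_sub h1 h2
    rw [hy] at this
    refine le_of_mul_le_mul_right ?_ hs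
    linear_combination this - (x - 1) * hσe
  have hright : ∀ x ∈ Set.Icc a (a + 1), y + σ * (x - 1) ≤ h x := by
    rintro x ⟨h1, -⟩
    have := hconv.mul_sub_le_mul_sub ha h1
    rw [hy] at this
    refine le_of_mul_le_mul_right ?_ hs
    linear_combination this + (x - 1) * hσe
  have hleft : ∀ r, ∀ x ∈ Set.Icc r 1, y + σ * (x - 1) ≤ h x := by
    rintro r x ⟨-, h2⟩
    have := hconv.mul_sub_le_mul_sub h2 ha
    rw [hy] at this
    refine le_of_mul_le_mul_right ?_ hs
    linear_combination this + (x - 1) * hσe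
  have bmid := quadratic_le_sub_of_affine_le_deriv (fun x => (hg x).neg) ha hmid
  have bright := quadratic_le_sub_of_affine_le_deriv hg (by linarith) hright
  -- The chord may become negative left of `1`, so it is used only on `[1 - v, 1]`; on `[0, 1 - v]`
  -- the bound `h ≥ 0` takes over.
  have bleft : ∀ v, 0 ≤ v → v ≤ 1 → y * v - σ * v ^ 2 / 2 ≤ g 1 - g 0 := by
    intro v hv0 hv1
    have h1 := quadratic_le_sub_of_affine_le_deriv hg (by linarith : 1 - v ≤ 1) (hleft (1 - v))
    have h2 : g 0 ≤ g (1 - v) := by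
      refine monotone_of_deriv_nonneg (fun x => (hg x).differentiableAt) (fun x => ?_)
        (by linarith)
      rw [(hg x).deriv]; exact hnn x
    linarith
  simp only [Pi.neg_apply] at bmid
  have b1 : g a - g 1 ≤ y * (a - 1) + σ * (a - 1) ^ 2 / 2 := by linarith
  have b2 : y + σ * ((a - 1) + 1 / 2) ≤ g (a + 1) - g a := by linarith
  have hK0 : 0 ≤ a ^ (2 * m - 1) - 1 := by linarith
  suffices hsuf : ∃ v, 0 ≤ v ∧ v ≤ 1 ∧ y * (a - 1) + σ * (a - 1) ^ 2 / 2 ≤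
      (a ^ (2 * m - 1) - 1) *
        (p * (y + σ * ((a - 1) + 1 / 2)) + (1 - p) * (y * v - σ * v ^ 2 / 2)) by
    obtain ⟨v, hv0, hv1, hv⟩ := hsuf
    refine b1.trans (hv.trans (mul_le_mul_of_nonneg_left ?_ hK0))
    exact add_le_add (mul_le_mul_of_nonneg_left b2 hp0.le)
      (mul_le_mul_of_nonneg_left (bleft v hv0 hv1) (by linarith))
  -- The chord vanishes at `1 - y / σ`, so the best `v` is `min (y / σ) 1`, and `v = 1` when the
  -- chord is constant.
  rcases hσ0.eq_or_lt with h0 | hpos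
  · refine ⟨1, zero_le_one, le_rfl, ?_⟩
    rw [← h0]
    nlinarith
  · have hyu : y = σ * (y / σ) := by field_simp
    have hu0 : 0 ≤ y / σ := by positivity
    set u := y / σ
    rcases le_total u 1 with hu | hu
    · refine ⟨u, hu0, hu, ?_⟩
      have := mul_le_mul_of_nonneg_left (two_point_inner hp hm ha hu0) (by positivity : 0 ≤ σ / 2)
      rw [hyu]
      linarith
    · refine ⟨1, zero_le_one, le_rfl, ?_⟩
      have := mul_le_mul_of_nonneg_left (two_point_outer hp hm ha hu) (by positivity : 0 ≤ σ / 2)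
      rw [hyu]
      linarith

/-- Rescaling by `b` and translating by `x₀` reduces to `four_point_unit`, once the sum in
parentheses on the right is subtracted from both sides. -/
theorem four_point {g h : ℝ → ℝ} {p m a b : ℝ} (hg : ∀ x, HasDerivAt g (h x) x)
    (hmono : Monotone h) (hconv : ConvexOn ℝ Set.univ h) (hnn : ∀ x, 0 ≤ h x)
    (hp : p ∈ Set.Ioo (0 : ℝ) 1) (hm : mStar p ≤ m) (hb : 0 < b) (hab : b ≤ a) (x₀ : ℝ) :
    p * (g (x₀ + a + b) - g (x₀ + b)) + (1 - p) * (g (x₀ + a) - g x₀) ≤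
      (a / b) ^ (2 * m - 1) *
      (p * (g (x₀ + a + b) - g (x₀ + a)) + (1 - p) * (g (x₀ + b) - g x₀)) := by
  have hG : ∀ x, HasDerivAt (fun x => g (x₀ + b * x)) (b * h (x₀ + b * x)) x := by
    intro x
    have h1 : HasDerivAt (fun x => x₀ + b * x) b x := by
      simpa using ((hasDerivAt_id x).const_mul b).const_add x₀
    exact ((hg _).comp x h1).congr_deriv (by ring)
  have hconv' : ConvexOn ℝ Set.univ (fun x => b * h (x₀ + b * x)) := by
    refine ⟨convex_univ, fun x _ y _ s t hs ht hst => ?_⟩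
    have := hconv.2 (Set.mem_univ (x₀ + b * x)) (Set.mem_univ (x₀ + b * y)) hs ht hst
    simp only [smul_eq_mul] at this ⊢
    have e : x₀ + b * (s * x + t * y) = s * (x₀ + b * x) + t * (x₀ + b * y) := by
      linear_combination -x₀ * hst
    rw [e]
    nlinarith [mul_le_mul_of_nonneg_left this hb.le]
  have hmono' : Monotone (fun x => b * h (x₀ + b * x)) := fun x y hxy =>
    mul_le_mul_of_nonneg_left (hmono (by nlinarith)) hb.le
  have key := four_point_unit hG hmono' hconv' (fun x => mul_nonneg hb.le (hnn _)) hp hm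
    ((one_le_div hb).2 hab)
  have e1 : x₀ + b * (a / b) = x₀ + a := by field_simp
  have e2 : x₀ + b * (a / b + 1) = x₀ + a + b := by field_simp; ring
  simp only [e1, e2, mul_one, mul_zero, add_zero] at key
  linarith

/-! ### Stability of the class under averaging -/

theorem classF3.exists_deriv {f : ℝ → ℝ} (hf : f ∈ classF3) :
    ∃ g h : ℝ → ℝ, (∀ x, HasDerivAt f (g x) x) ∧ (∀ x, HasDerivAt g (h x) x) ∧
      Monotone h ∧ ConvexOn ℝ Set.univ h ∧ ∀ x, 0 ≤ h x := by
  obtain ⟨hC, -, hconv, hm2, hc2⟩ := hf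
  have e : iteratedDeriv 2 f = deriv (deriv f) := by
    rw [iteratedDeriv_succ, iteratedDeriv_one]
  have hd1 : Differentiable ℝ f := hC.differentiable (by norm_num)
  have hd2 : Differentiable ℝ (deriv f) := by
    have := hC.differentiable_iteratedDeriv 1 (by norm_num)
    rwa [iteratedDeriv_one] at this
  rw [e] at hm2 hc2
  refine ⟨deriv f, deriv (deriv f), fun x => (hd1 x).hasDerivAt, fun x => (hd2 x).hasDerivAt,
    hm2, hc2, fun x => ?_⟩
  have : Monotone (deriv f) := by
    rw [← monotoneOn_univ]
    exact hconv.monotoneOn_deriv (fun x _ => hd1 x)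
  exact this.deriv_nonneg

theorem classF3.add {f₁ f₂ : ℝ → ℝ} (h₁ : f₁ ∈ classF3) (h₂ : f₂ ∈ classF3) :
    (fun x => f₁ x + f₂ x) ∈ classF3 := by
  obtain ⟨c1, m1, v1, mm1, vv1⟩ := h₁
  obtain ⟨c2, m2, v2, mm2, vv2⟩ := h₂
  have e : iteratedDeriv 2 (fun x => f₁ x + f₂ x)
      = iteratedDeriv 2 f₁ + iteratedDeriv 2 f₂ := by
    ext x
    rw [Pi.add_apply]
    exact iteratedDeriv_fun_add c1.contDiffAt c2.contDiffAt
  refine ⟨c1.add c2, m1.add m2, v1.add v2, ?_, ?_⟩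
  · rw [e]; exact mm1.add mm2
  · rw [e]; exact vv1.add vv2

theorem classF3.const_mul_comp_add {f : ℝ → ℝ} (hf : f ∈ classF3) {k : ℝ} (hk : 0 ≤ k)
    (b : ℝ) : (fun x => k * f (x + b)) ∈ classF3 := by
  obtain ⟨c1, m1, v1, mm1, vv1⟩ := hf
  have hcv : ∀ F : ℝ → ℝ, ConvexOn ℝ Set.univ F →
      ConvexOn ℝ Set.univ (fun x => k * F (x + b)) := by
    intro F hF
    have := (hF.translate_left b).smul hk
    simpa [Function.comp_def] using this
  have hmn : ∀ F : ℝ → ℝ, Monotone F → Monotone (fun x => k * F (x + b)) :=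
    fun F hF x y hxy => mul_le_mul_of_nonneg_left (hF (by linarith)) hk
  have e : iteratedDeriv 2 (fun x => k * f (x + b))
      = fun x => k * iteratedDeriv 2 f (x + b) := by
    ext x
    rw [iteratedDeriv_const_mul_field, iteratedDeriv_comp_add_const]
  refine ⟨by fun_prop, hmn _ m1, hcv _ v1, ?_, ?_⟩
  · rw [e]; exact hmn _ mm1
  · rw [e]; exact hcv _ vv1

/-- The average `E f (x + c B)`, where `B` has the standardized Bernoulli distribution. -/
noncomputable def bernAvg (p c : ℝ) (f : ℝ → ℝ) (x : ℝ) : ℝ :=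
  p * f (x + c * √((1 - p) / p)) + (1 - p) * f (x + c * (-√(p / (1 - p))))

theorem bernAvg_comm (p a b : ℝ) (f : ℝ → ℝ) :
    bernAvg p a (bernAvg p b f) = bernAvg p b (bernAvg p a f) := by
  ext x
  simp only [bernAvg, add_right_comm x (b * _)]
  ring

theorem bernAvg_mem_classF3 {p : ℝ} (hp : p ∈ Set.Ioo (0 : ℝ) 1) (c : ℝ) {f : ℝ → ℝ}
    (hf : f ∈ classF3) : bernAvg p c f ∈ classF3 :=
  classF3.add (classF3.const_mul_comp_add hf hp.1.le _)
    (classF3.const_mul_comp_add hf (sub_nonneg.2 hp.2.le) _)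

theorem stdBernoulli_atoms {p : ℝ} (hp : p ∈ Set.Ioo (0 : ℝ) 1) :
    ∃ r : ℝ, 0 < r ∧ r ^ 2 = p * (1 - p) ∧ √((1 - p) / p) = r / p ∧
      -√(p / (1 - p)) = -r / (1 - p) := by
  obtain ⟨h0, h1⟩ := hp
  have hq : 0 < 1 - p := by linarith
  have hpq : 0 < p * (1 - p) := mul_pos h0 hq
  have hr0 := Real.sqrt_pos.2 hpq
  have hr := Real.sq_sqrt hpq.le
  refine ⟨√(p * (1 - p)), hr0, hr, ?_, ?_⟩
  · rw [Real.sqrt_eq_iff_mul_self_eq_of_pos (by positivity)]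
    field_simp
    linarith
  · rw [neg_div, neg_inj, Real.sqrt_eq_iff_mul_self_eq_of_pos (by positivity)]
    field_simp
    linarith

/-! ### Transfers between two weights -/

theorem bernAvg_bernAvg_antitoneOn {p m M x : ℝ} {f : ℝ → ℝ} (hp : p ∈ Set.Ioo (0 : ℝ) 1)
    (hm : mStar p ≤ m) (hf : f ∈ classF3) :
    AntitoneOn (fun τ => bernAvg p ((M + τ) ^ (1 / (2 * m)))
      (bernAvg p ((M - τ) ^ (1 / (2 * m))) f) x) (Set.Icc 0 M) := by
  obtain ⟨g, h, hfg, hgh, hmono, hconv, hnn⟩ := classF3.exists_deriv hf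
  have hm1 : 1 ≤ m := (one_le_mStar hp.1).trans hm
  set α := 1 / (2 * m) with hα
  have hα0 : 0 < α := by positivity
  have hακ : (2 * m - 1) * α = 1 - α := by rw [hα]; field_simp
  obtain ⟨r, hr0, hr2, hX, hY⟩ := stdBernoulli_atoms hp
  obtain ⟨hp0, hp1⟩ := id hp
  have hq : 0 < 1 - p := by linarith
  simp only [bernAvg, hX, hY]
  have hfc : Continuous f := continuous_iff_continuousAt.2 fun x => (hfg x).continuousAt
  have hpow : Continuous fun t : ℝ => t ^ α := Real.continuous_rpow_const hα0.le
  have hu : Continuous fun τ : ℝ => (M + τ) ^ α := hpow.comp (by fun_prop)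
  have hv : Continuous fun τ : ℝ => (M - τ) ^ α := hpow.comp (by fun_prop)
  have hterm : ∀ X Y τ : ℝ, 0 < M + τ → 0 < M - τ →
      HasDerivAt (fun τ => f (x + (M + τ) ^ α * X + (M - τ) ^ α * Y))
      (g (x + (M + τ) ^ α * X + (M - τ) ^ α * Y) *
        (α * (M + τ) ^ (α - 1) * X - α * (M - τ) ^ (α - 1) * Y)) τ := by
    intro X Y τ h1 h2
    have d1 : HasDerivAt (fun τ => (M + τ) ^ α) (α * (M + τ) ^ (α - 1)) τ :=
      (((hasDerivAt_id τ).const_add M).rpow_const (p := α) (Or.inl h1.ne')).congr_deriv (by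
        simp)
    have d2 : HasDerivAt (fun τ => (M - τ) ^ α) (-(α * (M - τ) ^ (α - 1))) τ :=
      (((hasDerivAt_id τ).const_sub M).rpow_const (p := α) (Or.inl h2.ne')).congr_deriv (by
        simp)
    have d3 := ((d1.mul_const X).const_add x).fun_add (d2.mul_const Y)
    exact (HasDerivAt.comp τ (hfg _) d3).congr_deriv (by ring)
  refine antitoneOn_of_deriv_nonpos (convex_Icc 0 M) ?_ ?_ ?_
  · exact Continuous.continuousOn (by fun_prop)
  · intro τ hτ
    rw [interior_Icc] at hτ
    have h1 : 0 < M + τ := by linarith [hτ.1, hτ.2]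
    have h2 : 0 < M - τ := by linarith [hτ.2]
    have H := fun X Y => (hterm X Y τ h1 h2).differentiableAt
    exact DifferentiableAt.differentiableWithinAt
      ((((H _ _).const_mul _).add ((H _ _).const_mul _)).const_mul _ |>.add
        ((((H _ _).const_mul _).add ((H _ _).const_mul _)).const_mul _))
  · intro τ hτ
    rw [interior_Icc] at hτ
    have h1 : 0 < M + τ := by linarith [hτ.1, hτ.2]
    have h2 : 0 < M - τ := by linarith [hτ.2]
    have H := fun X Y => hterm X Y τ h1 h2
    have HD := ((((H (r / p) (r / p)).const_mul p).fun_add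
      ((H (r / p) (-r / (1 - p))).const_mul (1 - p))).const_mul p).fun_add
        ((((H (-r / (1 - p)) (r / p)).const_mul p).fun_add
          ((H (-r / (1 - p)) (-r / (1 - p))).const_mul (1 - p))).const_mul (1 - p))
    rw [HasDerivAt.deriv HD]
    set u := (M + τ) ^ α with hu'
    set v := (M - τ) ^ α with hv'
    have hv0 : 0 < v := Real.rpow_pos_of_pos h2 _
    have huv : v ≤ u := Real.rpow_le_rpow h2.le (by linarith [hτ.1]) hα0.le
    -- `ρ` is the distance between the two atoms, so the four values of the sum are the lowest one
    -- shifted by `0`, `ρ v`, `ρ u` and `ρ u + ρ v`.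
    set ρ := r / p + r / (1 - p) with hρ
    have hρ0 : 0 < ρ := by positivity
    have key := four_point hgh hmono hconv hnn hp hm (mul_pos hρ0 hv0)
      (mul_le_mul_of_nonneg_left huv hρ0.le) (x + u * (-r / (1 - p)) + v * (-r / (1 - p)))
    have e1 : x + u * (-r / (1 - p)) + v * (-r / (1 - p)) + ρ * u + ρ * v
        = x + u * (r / p) + v * (r / p) := by rw [hρ]; ring
    have e2 : x + u * (-r / (1 - p)) + v * (-r / (1 - p)) + ρ * u
        = x + u * (r / p) + v * (-r / (1 - p)) := by rw [hρ]; ring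
    have e3 : x + u * (-r / (1 - p)) + v * (-r / (1 - p)) + ρ * v
        = x + u * (-r / (1 - p)) + v * (r / p) := by rw [hρ]; ring
    rw [e1, e2, e3, mul_div_mul_left _ _ hρ0.ne'] at key
    -- By `(2m - 1) α = 1 - α` this factor is the ratio of the speeds at which `v` falls and `u`
    -- grows with `τ`.
    have e4 : (u / v) ^ (2 * m - 1) = (M - τ) ^ (α - 1) * (M + τ) ^ (1 - α) := by
      rw [Real.div_rpow (hv0.le.trans huv) hv0.le, hu', hv', ← Real.rpow_mul h1.le,
        ← Real.rpow_mul h2.le, mul_comm α, hακ, div_eq_mul_inv, ← Real.rpow_neg h2.le, neg_sub,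
        mul_comm]
    have e5 : (M + τ) ^ (α - 1) * (M + τ) ^ (1 - α) = 1 := by
      rw [← Real.rpow_add h1]; simp
    rw [e4] at key
    have hc : 0 ≤ α * r * (M + τ) ^ (α - 1) := by positivity
    have key2 := mul_le_mul_of_nonneg_left key hc
    set P := (M + τ) ^ (α - 1)
    set P' := (M + τ) ^ (1 - α)
    set Q := (M - τ) ^ (α - 1)
    generalize g (x + u * (r / p) + v * (r / p)) = g1 at *
    generalize g (x + u * (r / p) + v * (-r / (1 - p))) = g2 at *
    generalize g (x + u * (-r / (1 - p)) + v * (r / p)) = g3 at *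
    generalize g (x + u * (-r / (1 - p)) + v * (-r / (1 - p))) = g4 at *
    have e6 : p * (p * (g1 * (α * P * (r / p) - α * Q * (r / p))) +
        (1 - p) * (g2 * (α * P * (r / p) - α * Q * (-r / (1 - p))))) +
        (1 - p) * (p * (g3 * (α * P * (-r / (1 - p)) - α * Q * (r / p))) +
        (1 - p) * (g4 * (α * P * (-r / (1 - p)) - α * Q * (-r / (1 - p))))) =
        α * r * P * (p * (g1 - g3) + (1 - p) * (g2 - g4)) -
        α * r * Q * (p * (g1 - g2) + (1 - p) * (g3 - g4)) := by
      field_simp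
      ring
    rw [e6]
    linear_combination key2 + α * r * Q * (p * (g1 - g2) + (1 - p) * (g3 - g4)) * e5

/-- The pairs `(a, b)` and `(c, a + b - c)` have the same midpoint, and the second has the smaller
half-difference `τ`. -/
theorem bernAvg_pair_le {p m a b c x : ℝ} {f : ℝ → ℝ} (hp : p ∈ Set.Ioo (0 : ℝ) 1)
    (hm : mStar p ≤ m) (hf : f ∈ classF3) (ha : 0 ≤ a) (hac : a ≤ c) (hcb : c ≤ b) :
    bernAvg p (a ^ (1 / (2 * m))) (bernAvg p (b ^ (1 / (2 * m))) f) x ≤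
      bernAvg p (c ^ (1 / (2 * m))) (bernAvg p ((a + b - c) ^ (1 / (2 * m))) f) x := by
  have hanti := bernAvg_bernAvg_antitoneOn (M := (a + b) / 2) (x := x) hp hm hf
  have h1 : (b - a) / 2 ∈ Set.Icc 0 ((a + b) / 2) := ⟨by linarith, by linarith⟩
  have e1 : (a + b) / 2 + (b - a) / 2 = b := by ring
  have e2 : (a + b) / 2 - (b - a) / 2 = a := by ring
  rw [bernAvg_comm]
  rcases le_total ((a + b) / 2) c with h | h
  · have h2 : c - (a + b) / 2 ∈ Set.Icc 0 ((a + b) / 2) := ⟨by linarith, by linarith⟩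
    have := hanti h2 h1 (by linarith)
    have e3 : (a + b) / 2 + (c - (a + b) / 2) = c := by ring
    have e4 : (a + b) / 2 - (c - (a + b) / 2) = a + b - c := by ring
    simpa only [e1, e2, e3, e4] using this
  · rw [bernAvg_comm p (c ^ _)]
    have h2 : (a + b) / 2 - c ∈ Set.Icc 0 ((a + b) / 2) := ⟨by linarith, by linarith⟩
    have := hanti h2 h1 (by linarith)
    have e3 : (a + b) / 2 + ((a + b) / 2 - c) = a + b - c := by ring
    have e4 : (a + b) / 2 - ((a + b) / 2 - c) = c := by ring
    simpa only [e1, e2, e3, e4] using this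

/-! ### From pairs to all weights -/

/-- Makes the fold over a multiset well defined: the order of the weights is irrelevant. -/
instance bernAvg_leftCommutative (p : ℝ) : LeftCommutative (bernAvg p) := ⟨bernAvg_comm p⟩

/-- The iterated average `E f (x + ∑ c B_c)`, `c` running through a multiset. -/
noncomputable def bernAvgs (p : ℝ) (s : Multiset ℝ) (f : ℝ → ℝ) : ℝ → ℝ :=
  s.foldr (bernAvg p) f

theorem bernAvgs_cons (p a : ℝ) (s : Multiset ℝ) (f : ℝ → ℝ) :
    bernAvgs p (a ::ₘ s) f = bernAvg p a (bernAvgs p s f) := by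
  simp [bernAvgs]

theorem bernAvgs_bernAvg (p a : ℝ) (s : Multiset ℝ) (f : ℝ → ℝ) :
    bernAvgs p s (bernAvg p a f) = bernAvg p a (bernAvgs p s f) := by
  induction s using Multiset.induction with
  | empty => simp [bernAvgs]
  | cons b s ih => rw [bernAvgs_cons, bernAvgs_cons, ih, bernAvg_comm]

theorem bernAvgs_mem_classF3 {p : ℝ} (hp : p ∈ Set.Ioo (0 : ℝ) 1) (s : Multiset ℝ)
    {f : ℝ → ℝ} (hf : f ∈ classF3) : bernAvgs p s f ∈ classF3 := by
  induction s using Multiset.induction with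
  | empty => simpa [bernAvgs] using hf
  | cons b s ih => rw [bernAvgs_cons]; exact bernAvg_mem_classF3 hp b ih

theorem Multiset.exists_ge_of_sum_eq {s : Multiset ℝ} {M : ℝ} (hs : s ≠ 0)
    (h : s.card * M ≤ s.sum) : ∃ b ∈ s, M ≤ b := by
  by_contra! hcon
  have := Multiset.sum_lt_sum_of_nonempty (f := id) (g := fun _ => M) hs hcon
  simp at this
  linarith

theorem Multiset.exists_le_of_sum_eq {s : Multiset ℝ} {M : ℝ} (hs : s ≠ 0)
    (h : s.sum ≤ s.card * M) : ∃ b ∈ s, b ≤ M := by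
  by_contra! hcon
  have := Multiset.sum_lt_sum_of_nonempty (f := fun _ => M) (g := id) hs hcon
  simp at this
  linarith

theorem Multiset.exists_cons_cons_of_sum_eq {s : Multiset ℝ} {M : ℝ} (hs : 2 ≤ s.card)
    (h : s.sum = s.card * M) : ∃ a b t, s = a ::ₘ b ::ₘ t ∧ a ≤ M ∧ M ≤ b := by
  have hs0 : s ≠ 0 := by rintro rfl; simp at hs
  obtain ⟨a, has, haM⟩ := Multiset.exists_le_of_sum_eq hs0 h.le
  obtain ⟨t, rfl⟩ := Multiset.exists_cons_of_mem has
  rw [Multiset.sum_cons, Multiset.card_cons] at h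
  push_cast at h
  have ht0 : t ≠ 0 := by rintro rfl; simp at hs
  obtain ⟨b, hbt, hbM⟩ := Multiset.exists_ge_of_sum_eq (M := M) ht0 (by linarith)
  obtain ⟨t', rfl⟩ := Multiset.exists_cons_of_mem hbt
  exact ⟨a, b, t', rfl, haM, hbM⟩

/-- Some `a ≤ M ≤ b` occur among the variables. A transfer changes them to `M` and `a + b - M`; the
summand of `M` is absorbed into `f`, and the other `n` variables still have mean `M`. -/
theorem bernAvgs_le_replicate {p m M : ℝ} (hp : p ∈ Set.Ioo (0 : ℝ) 1) (hm : mStar p ≤ m)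
    (n : ℕ) : ∀ (s : Multiset ℝ) (f : ℝ → ℝ) (x : ℝ), f ∈ classF3 → s.card = n →
      s.sum = n * M → (∀ t ∈ s, 0 ≤ t) →
      bernAvgs p (s.map (· ^ (1 / (2 * m)))) f x ≤
        bernAvgs p (Multiset.replicate n (M ^ (1 / (2 * m)))) f x := by
  induction n with
  | zero =>
    intro s f x hf hs _ _
    rw [Multiset.card_eq_zero] at hs
    simp [hs]
  | succ n ih =>
    intro s f x hf hs hsum hnn
    rcases Nat.eq_zero_or_pos n with rfl | hn
    · obtain ⟨a, rfl⟩ := Multiset.card_eq_one.1 hs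
      simp at hsum
      simp [hsum]
    · obtain ⟨a, b, t, rfl, haM, hMb⟩ :=
        Multiset.exists_cons_cons_of_sum_eq (s := s) (M := M) (by omega) (by rw [hsum, hs])
      have ha : 0 ≤ a := hnn a (by simp)
      have hpair := bernAvg_pair_le (x := x) hp hm
        (bernAvgs_mem_classF3 hp (t.map (· ^ (1 / (2 * m)))) hf) ha haM hMb
      have hIH := ih ((a + b - M) ::ₘ t) (bernAvg p (M ^ (1 / (2 * m))) f) x
        (bernAvg_mem_classF3 hp _ hf) (by simpa using hs)
        (by
          simp only [Multiset.sum_cons] at hsum ⊢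
          push_cast at hsum
          linarith)
        (by
          intro y hy
          rcases Multiset.mem_cons.1 hy with rfl | hy
          · linarith
          · exact hnn y (by simp [hy]))
      rw [bernAvgs_bernAvg, bernAvgs_bernAvg, Multiset.map_cons, bernAvgs_cons] at hIH
      rw [Multiset.map_cons, Multiset.map_cons, bernAvgs_cons, bernAvgs_cons,
        Multiset.replicate_succ, bernAvgs_cons]
      exact hpair.trans hIH

/-! ### Expectations as iterated averages -/

theorem sum_bool_eq_bernAvgs (p : ℝ) (f : ℝ → ℝ) (n : ℕ) : ∀ (c : Fin n → ℝ) (x : ℝ),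
    ∑ b : Fin n → Bool, (∏ i, if b i then p else 1 - p) *
      f (x + ∑ i, c i * if b i then √((1 - p) / p) else -√(p / (1 - p))) =
    bernAvgs p (Finset.univ.val.map c) f x := by
  induction n with
  | zero => intro c x; simp [bernAvgs]
  | succ n ih =>
    intro c x
    rw [Fin.univ_val_map, List.ofFn_succ, ← Multiset.cons_coe, ← Fin.univ_val_map,
      bernAvgs_cons, bernAvg, ← ih, ← ih,
      ← (Fin.consEquiv fun _ => Bool).sum_comp, Fintype.sum_prod_type, Fintype.sum_bool]
    simp only [Fin.consEquiv_apply, Fin.prod_univ_succ, Fin.sum_univ_succ, Fin.cons_zero,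
      Fin.cons_succ, if_true, Finset.mul_sum, Bool.false_eq_true, if_false, mul_assoc, add_assoc]

theorem stdBernoulli_eq_map (p : ℝ) (hp : p ∈ Set.Ioo (0 : ℝ) 1) :
    stdBernoulli p hp = (bernoulliMeasure true false ⟨p, hp.1.le, hp.2.le⟩).map
      (fun b : Bool => if b then √((1 - p) / p) else -√(p / (1 - p))) := by
  rw [map_bernoulliMeasure]
  simp [stdBernoulli]

theorem integral_comp_sum_eq_bernAvgs {Ω : Type*} [MeasurableSpace Ω] {P : Measure Ω}
    [IsProbabilityMeasure P] {n : ℕ} {p : ℝ} {hp : p ∈ Set.Ioo (0 : ℝ) 1}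
    {X : Fin n → Ω → ℝ} (hX : IsIIDStdBernoulli p hp X P) {f : ℝ → ℝ} (hf : Continuous f)
    (c : Fin n → ℝ) :
    ∫ ω, f (∑ i, c i * X i ω) ∂P = bernAvgs p (Finset.univ.val.map c) f 0 := by
  have hm : ∀ i, AEMeasurable (X i) P := fun i => (hX.hasLaw i).aemeasurable
  have hmap := (iIndepFun_iff_map_fun_eq_pi_map hm).1 hX.indep
  simp only [fun i => (hX.hasLaw i).map_eq, stdBernoulli_eq_map] at hmap
  rw [← Measure.pi_map_pi (fun _ => by fun_prop)] at hmap
  have hF : Continuous fun y : Fin n → ℝ => f (∑ i, c i * y i) := by fun_prop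
  rw [← integral_map (φ := fun ω i => X i ω) (f := fun y => f (∑ i, c i * y i))
    (aemeasurable_pi_lambda _ hm) hF.aestronglyMeasurable, hmap,
    integral_map (by fun_prop) hF.aestronglyMeasurable, integral_fintype .of_finite,
    ← sum_bool_eq_bernAvgs]
  refine Finset.sum_congr rfl fun b _ => ?_
  rw [smul_eq_mul, zero_add]
  congr 1
  rw [measureReal_def, Measure.pi_singleton, ENNReal.toReal_prod]
  refine Finset.prod_congr rfl fun i _ => ?_
  rw [← measureReal_def]
  cases b i <;> simp

theorem integral_comp_mul_sum_eq_bernAvgs {Ω : Type*} [MeasurableSpace Ω] {P : Measure Ω}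
    [IsProbabilityMeasure P] {n : ℕ} {p : ℝ} {hp : p ∈ Set.Ioo (0 : ℝ) 1}
    {X : Fin n → Ω → ℝ} (hX : IsIIDStdBernoulli p hp X P) {f : ℝ → ℝ} (hf : Continuous f)
    (s : ℝ) :
    ∫ ω, f (s * ∑ i, X i ω) ∂P = bernAvgs p (Multiset.replicate n s) f 0 := by
  have := integral_comp_sum_eq_bernAvgs hX hf (fun _ => s)
  simpa [Finset.mul_sum] using this

theorem integral_comp_sum_le {p m : ℝ} {hp : p ∈ Set.Ioo (0 : ℝ) 1} (hm : mStar p ≤ m)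
    {f : ℝ → ℝ} (hf : f ∈ classF3) {n : ℕ} (hn : 1 ≤ n) {c : Fin n → ℝ} (hc : ∀ i, 0 ≤ c i)
    {Ω : Type*} [MeasurableSpace Ω] {P : Measure Ω} [IsProbabilityMeasure P]
    {X : Fin n → Ω → ℝ} (hX : IsIIDStdBernoulli p hp X P) :
    ∫ ω, f (∑ i, c i * X i ω) ∂P ≤ ∫ ω, f (powerMean m c * ∑ i, X i ω) ∂P := by
  have hm0 : 0 < m := zero_lt_one.trans_le ((one_le_mStar hp.1).trans hm)
  rw [integral_comp_sum_eq_bernAvgs hX hf.1.continuous,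
    integral_comp_mul_sum_eq_bernAvgs hX hf.1.continuous]
  have := bernAvgs_le_replicate (M := 1 / (n : ℝ) * ∑ i, c i ^ (2 * m)) hp hm n
    (Finset.univ.val.map fun i => c i ^ (2 * m)) f 0 hf (by simp)
    (by
      have : (n : ℝ) ≠ 0 := by positivity
      field_simp
      rfl)
    (by
      intro t ht
      obtain ⟨i, -, rfl⟩ := Multiset.mem_map.1 ht
      exact Real.rpow_nonneg (hc i) _)
  rw [Multiset.map_map] at this
  have e : ((fun t : ℝ => t ^ (1 / (2 * m))) ∘ fun i => c i ^ (2 * m)) = c := by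
    ext i
    rw [Function.comp_apply, ← Real.rpow_mul (hc i), mul_one_div_cancel (by positivity),
      Real.rpow_one]
  rwa [e] at this

/-! ### Exactness of the threshold -/

theorem hasDerivAt_max_zero_pow (k : ℕ) (x : ℝ) :
    HasDerivAt (fun x : ℝ => max x 0 ^ (k + 2)) ((k + 2) * max x 0 ^ (k + 1)) x := by
  rcases lt_trichotomy x 0 with hx | rfl | hx
  · have h : (fun x : ℝ => max x 0 ^ (k + 2)) =ᶠ[nhds x] fun _ => 0 := by
      filter_upwards [eventually_lt_nhds hx] with y hy
      simp [max_eq_right hy.le]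
    rw [max_eq_right hx.le]
    simpa using (hasDerivAt_const x (0 : ℝ)).congr_of_eventuallyEq h
  · rw [hasDerivAt_iff_tendsto_slope_zero]
    have h : Filter.Tendsto (fun t : ℝ => max t 0 ^ (k + 1)) (nhds 0) (nhds 0) := by
      have : Continuous fun t : ℝ => max t 0 ^ (k + 1) := by fun_prop
      simpa using this.tendsto 0
    have h2 := h.mono_left (nhdsWithin_le_nhds (s := {0}ᶜ))
    simp only [max_self, ne_eq, Nat.succ_ne_zero, not_false_eq_true, zero_pow, mul_zero]
    refine h2.congr' ?_
    filter_upwards [self_mem_nhdsWithin] with t ht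
    rcases lt_or_gt_of_ne (show t ≠ 0 from ht) with h0 | h0
    · simp [max_eq_right h0.le]
    · simp only [zero_add, max_eq_left h0.le, smul_eq_mul]
      field_simp
      simp [pow_succ]
  · have h : (fun x : ℝ => max x 0 ^ (k + 2)) =ᶠ[nhds x] fun x => x ^ (k + 2) := by
      filter_upwards [eventually_gt_nhds hx] with y hy
      simp [max_eq_left hy.le]
    rw [max_eq_left hx.le]
    simpa using (hasDerivAt_pow (k + 2) x).congr_of_eventuallyEq h

theorem posPart_sub_cube_mem_classF3 (t : ℝ) : (fun x => max (x - t) 0 ^ 3) ∈ classF3 := by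
  have h1 : ∀ x, HasDerivAt (fun x => max (x - t) 0 ^ 3) (3 * max (x - t) 0 ^ 2) x := by
    intro x
    have := (hasDerivAt_max_zero_pow 1 (x - t)).comp_sub_const x t
    norm_num at this
    exact this
  have h2 : ∀ x, HasDerivAt (fun x => 3 * max (x - t) 0 ^ 2) (6 * max (x - t) 0) x := by
    intro x
    have := ((hasDerivAt_max_zero_pow 0 (x - t)).comp_sub_const x t).const_mul 3
    norm_num at this
    exact this.congr_deriv (by ring)
  have d1 : deriv (fun x => max (x - t) 0 ^ 3) = fun x => 3 * max (x - t) 0 ^ 2 :=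
    funext fun x => (h1 x).deriv
  have d2 : deriv (fun x => 3 * max (x - t) 0 ^ 2) = fun x => 6 * max (x - t) 0 :=
    funext fun x => (h2 x).deriv
  have e : iteratedDeriv 2 (fun x => max (x - t) 0 ^ 3) = fun x => 6 * max (x - t) 0 := by
    rw [iteratedDeriv_succ, iteratedDeriv_one, d1, d2]
  have hmax : Monotone fun x : ℝ => max (x - t) 0 := fun x y hxy =>
    max_le_max (by linarith) le_rfl
  refine ⟨?_, ?_, ?_, ?_, ?_⟩
  · have c1 : ContDiff ℝ 1 (fun x => 3 * max (x - t) 0 ^ 2) := by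
      rw [contDiff_one_iff_deriv, d2]
      exact ⟨fun x => (h2 x).differentiableAt, by fun_prop⟩
    have := (contDiff_succ_iff_deriv (𝕜 := ℝ) (n := 1)
      (f := fun x => max (x - t) 0 ^ 3)).2
      ⟨fun x => (h1 x).differentiableAt, by simp, by rw [d1]; exact c1⟩
    simpa [one_add_one_eq_two] using this
  · exact fun x y hxy => pow_le_pow_left₀ (le_max_right _ _) (hmax hxy) 3
  · refine Monotone.convexOn_univ_of_deriv (fun x => (h1 x).differentiableAt) ?_
    rw [d1]
    exact fun x y hxy => mul_le_mul_of_nonneg_left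
      (pow_le_pow_left₀ (le_max_right _ _) (hmax hxy) 2) (by norm_num)
  · rw [e]
    exact fun x y hxy => mul_le_mul_of_nonneg_left (hmax hxy) (by norm_num)
  · rw [e]
    have hl : ConvexOn ℝ Set.univ fun x : ℝ => x - t :=
      (convexOn_id convex_univ).sub (concaveOn_const t convex_univ)
    exact (hl.sup (convexOn_const 0 convex_univ)).smul (by norm_num : (0 : ℝ) ≤ 6)

/-- Zero mean and unit variance remove all mixed terms from the third moment. -/
theorem bernAvg_pair_cube {p X Y a b z : ℝ} (h1 : p * X + (1 - p) * Y = 0)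
    (h2 : p * X ^ 2 + (1 - p) * Y ^ 2 = 1) :
    p * (p * (z + a * X + b * X) ^ 3 + (1 - p) * (z + a * X + b * Y) ^ 3) +
      (1 - p) * (p * (z + a * Y + b * X) ^ 3 + (1 - p) * (z + a * Y + b * Y) ^ 3) =
    (a ^ 3 + b ^ 3) * (p * X ^ 3 + (1 - p) * Y ^ 3) + 3 * z * (a ^ 2 + b ^ 2) + z ^ 3 := by
  have inner : ∀ z b : ℝ, p * (z + b * X) ^ 3 + (1 - p) * (z + b * Y) ^ 3 =
      z ^ 3 + 3 * z * b ^ 2 + b ^ 3 * (p * X ^ 3 + (1 - p) * Y ^ 3) := by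
    intro z b
    linear_combination 3 * z ^ 2 * b * h1 + 3 * z * b ^ 2 * h2
  rw [inner, inner]
  linear_combination inner z a + 3 * b ^ 2 * a * h1

theorem exists_pair_of_lt_one {p m : ℝ} (hp : p ∈ Set.Ioo (0 : ℝ) 1) (hm0 : 0 < m)
    (hm : m < 1) : ∃ f ∈ classF3, ∃ a b : ℝ, 0 ≤ a ∧ 0 ≤ b ∧
      bernAvg p (((a ^ (2 * m) + b ^ (2 * m)) / 2) ^ (1 / (2 * m)))
        (bernAvg p (((a ^ (2 * m) + b ^ (2 * m)) / 2) ^ (1 / (2 * m))) f) 0 <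
      bernAvg p a (bernAvg p b f) 0 := by
  obtain ⟨r, hr0, hr2, hX, hY⟩ := stdBernoulli_atoms hp
  obtain ⟨hp0, hp1⟩ := hp
  have hq : 0 < 1 - p := by linarith
  -- The power mean of `(1, 0)`. For `m < 1` it satisfies `2 σ² < 1`, so the variance falls.
  set σ : ℝ := (1 / 2) ^ (1 / (2 * m)) with hσ
  have hσ0 : 0 < σ := by positivity
  have hσ1 : σ ≤ 1 := Real.rpow_le_one (by norm_num) (by norm_num) (by positivity)
  have hσ2 : 0 < 1 - 2 * σ ^ 2 := by
    have : σ ^ 2 < 1 / 2 := by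
      rw [hσ, ← Real.rpow_natCast, ← Real.rpow_mul (by norm_num)]
      have e : 1 / (2 * m) * ((2 : ℕ) : ℝ) = 1 / m := by push_cast; field_simp
      rw [e]
      have h := Real.rpow_lt_rpow_of_exponent_gt (by norm_num : (0 : ℝ) < 1 / 2) (by norm_num)
        ((one_lt_div hm0).2 hm)
      rwa [Real.rpow_one] at h
    linarith
  set X := r / p
  set Y := -r / (1 - p) with hYd
  have hX0 : 0 < X := by positivity
  have hY0 : 0 < -Y := by rw [hYd, neg_div, neg_neg]; positivity
  have h1 : p * X + (1 - p) * Y = 0 := by simp only [X, Y]; field_simp; ring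
  have h2 : p * X ^ 2 + (1 - p) * Y ^ 2 = 1 := by
    simp only [X, Y]; field_simp; linear_combination hr2
  set μ := p * X ^ 3 + (1 - p) * Y ^ 3
  -- The first summand keeps every value of the sum to the right of the kink `-T`; the second makes
  -- the variance gain `3T (1 - 2σ²)` exceed the change in the third moment.
  set T := 2 * (-Y) + (|μ| + 1) / (3 * (1 - 2 * σ ^ 2)) with hT
  have hTpos : 2 * (-Y) ≤ T := by rw [hT, le_add_iff_nonneg_right]; positivity
  have hTbig : |μ| + 1 ≤ 3 * T * (1 - 2 * σ ^ 2) := by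
    have : 3 * T * (1 - 2 * σ ^ 2) = 6 * (-Y) * (1 - 2 * σ ^ 2) + (|μ| + 1) := by
      rw [hT]; field_simp; ring
    rw [this]
    have : 0 ≤ 6 * (-Y) * (1 - 2 * σ ^ 2) := by positivity
    linarith
  refine ⟨_, posPart_sub_cube_mem_classF3 (-T), 1, 0, zero_le_one, le_rfl, ?_⟩
  have hmax : ∀ x, -T ≤ x → max (x - -T) 0 ^ 3 = (T + x) ^ 3 := by
    intro x hx
    rw [max_eq_left (by linarith)]; ring
  have hge : ∀ a b u v : ℝ, 0 ≤ a → a ≤ 1 → 0 ≤ b → b ≤ 1 → Y ≤ u → Y ≤ v →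
      -T ≤ 0 + a * u + b * v := by
    intro a b u v ha0 ha1 hb0 hb1 hu hv
    have i1 := mul_le_mul_of_nonneg_left hu ha0
    have i2 := mul_le_mul_of_nonneg_left hv hb0
    nlinarith
  have hYX : Y ≤ X := by linarith
  rw [Real.one_rpow, Real.zero_rpow (by positivity), add_zero]
  simp only [bernAvg, hX, hY]
  rw [← hσ, hmax _ (hge σ σ X X hσ0.le hσ1 hσ0.le hσ1 hYX hYX),
    hmax _ (hge σ σ X Y hσ0.le hσ1 hσ0.le hσ1 hYX le_rfl),
    hmax _ (hge σ σ Y X hσ0.le hσ1 hσ0.le hσ1 le_rfl hYX),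
    hmax _ (hge σ σ Y Y hσ0.le hσ1 hσ0.le hσ1 le_rfl le_rfl),
    hmax _ (hge 1 0 X X zero_le_one le_rfl le_rfl zero_le_one hYX hYX),
    hmax _ (hge 1 0 X Y zero_le_one le_rfl le_rfl zero_le_one hYX le_rfl),
    hmax _ (hge 1 0 Y X zero_le_one le_rfl le_rfl zero_le_one le_rfl hYX),
    hmax _ (hge 1 0 Y Y zero_le_one le_rfl le_rfl zero_le_one le_rfl le_rfl)]
  simp only [zero_add, ← add_assoc]
  rw [bernAvg_pair_cube h1 h2, bernAvg_pair_cube h1 h2]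
  have hμ : (2 * σ ^ 3 - 1) * μ ≤ |μ| := by
    refine (le_abs_self _).trans ?_
    rw [abs_mul]
    have h3 : σ ^ 3 ≤ 1 := pow_le_one₀ hσ0.le hσ1
    have h4 : 0 ≤ σ ^ 3 := by positivity
    exact mul_le_of_le_one_left (abs_nonneg _) (abs_le.2 ⟨by linarith, by linarith⟩)
  change (σ ^ 3 + σ ^ 3) * μ + 3 * T * (σ ^ 2 + σ ^ 2) + T ^ 3 <
    (1 ^ 3 + 0 ^ 3) * μ + 3 * T * (1 ^ 2 + 0 ^ 2) + T ^ 3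
  linarith

/-- A second-order expansion by one use of l'Hôpital's rule; the remaining quotient is a difference
quotient of `F'` at `0`. -/
theorem tendsto_sub_div_sq {F F' : ℝ → ℝ} {L : ℝ}
    (hF : ∀ᶠ x in nhds 0, HasDerivAt F (F' x) x) (h0 : F' 0 = 0) (hF' : HasDerivAt F' L 0) :
    Filter.Tendsto (fun x => (F x - F 0) / x ^ 2) (nhdsWithin 0 (Set.Ioi 0)) (nhds (L / 2)) := by
  have hle : nhdsWithin (0 : ℝ) (Set.Ioi 0) ≤ nhds 0 := nhdsWithin_le_nhds
  refine HasDerivAt.lhopital_zero_nhdsGT (f' := F') (g' := fun x => 2 * x) ?_ ?_ ?_ ?_ ?_ ?_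
  · exact (hF.filter_mono hle).mono fun x hx => hx.sub_const _
  · exact Filter.Eventually.of_forall fun x => by simpa using hasDerivAt_pow 2 x
  · filter_upwards [self_mem_nhdsWithin] with x hx
    have : (0 : ℝ) < x := hx
    positivity
  · have := (hF.self_of_nhds.continuousAt.tendsto.sub_const (F 0)).mono_left hle
    simpa using this
  · have : Continuous fun x : ℝ => x ^ 2 := by fun_prop
    simpa using (this.tendsto 0).mono_left hle
  · have h1 := (hasDerivAt_iff_tendsto_slope_zero.1 hF').mono_left
      (nhdsWithin_mono 0 fun x (hx : 0 < x) => hx.ne')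
    refine (h1.div_const 2).congr fun x => ?_
    simp only [zero_add, h0, sub_zero, smul_eq_mul]
    rw [mul_comm 2 x, ← div_div, inv_mul_eq_div]

theorem tendsto_rpow_mean_sub_one_div_sq (m : ℝ) :
    Filter.Tendsto (fun ε : ℝ => (((1 + ε) ^ (2 * m) + (1 - ε) ^ (2 * m)) / 2 - 1) / ε ^ 2)
      (nhdsWithin 0 (Set.Ioi 0)) (nhds (m * (2 * m - 1))) := by
  have hd : ∀ α x : ℝ, -1 < x → x < 1 →
      HasDerivAt (fun x : ℝ => (1 + x) ^ α) (α * (1 + x) ^ (α - 1)) x ∧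
      HasDerivAt (fun x : ℝ => (1 - x) ^ α) (-(α * (1 - x) ^ (α - 1))) x := by
    intro α x h1 h2
    have p1 : 1 + x ≠ 0 := by linarith
    have p2 : 1 - x ≠ 0 := by linarith
    exact ⟨(((hasDerivAt_id x).const_add 1).rpow_const (p := α) (Or.inl p1)).congr_deriv
        (by simp),
      (((hasDerivAt_id x).const_sub 1).rpow_const (p := α) (Or.inl p2)).congr_deriv (by simp)⟩
  have := tendsto_sub_div_sq
    (F := fun x : ℝ => ((1 + x) ^ (2 * m) + (1 - x) ^ (2 * m)) / 2)
    (F' := fun x : ℝ => m * ((1 + x) ^ (2 * m - 1) - (1 - x) ^ (2 * m - 1)))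
    (L := 2 * (m * (2 * m - 1))) ?_ (by simp) ?_
  · simpa using this
  · filter_upwards [Ioo_mem_nhds (by norm_num : (-1 : ℝ) < 0) (by norm_num : (0 : ℝ) < 1)]
      with x hx
    obtain ⟨a1, a2⟩ := hd (2 * m) x hx.1 hx.2
    exact ((a1.fun_add a2).div_const 2).congr_deriv (by ring)
  · obtain ⟨a1, a2⟩ := hd (2 * m - 1) 0 (by norm_num) (by norm_num)
    exact ((a1.fun_sub a2).const_mul m).congr_deriv (by simp; ring)

theorem exists_pair_of_lt_half {p m : ℝ} (hp0 : 0 < p) (hp : p < 1 / 2) (hm0 : 0 < m)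
    (hm : m < mStar p) : ∃ f ∈ classF3, ∃ a b : ℝ, 0 ≤ a ∧ 0 ≤ b ∧
      bernAvg p (((a ^ (2 * m) + b ^ (2 * m)) / 2) ^ (1 / (2 * m)))
        (bernAvg p (((a ^ (2 * m) + b ^ (2 * m)) / 2) ^ (1 / (2 * m))) f) 0 <
      bernAvg p a (bernAvg p b f) 0 := by
  obtain ⟨r, hr0, hr2, hX, hY⟩ := stdBernoulli_atoms (p := p) ⟨hp0, by linarith⟩
  have hq : 0 < 1 - p := by linarith
  have hκ : (2 * m - 1) * (p + r) < 1 := by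
    have h := mStar_eq_of_le_half hp0 hp.le
    have e : √(p - p ^ 2) = r := by
      rw [Real.sqrt_eq_iff_mul_self_eq_of_pos hr0]; linarith
    rw [e] at h
    rw [← lt_div_iff₀ (by positivity)]
    linarith
  have hrq : r < 1 - p := by
    refine lt_of_pow_lt_pow_left₀ 2 hq.le ?_
    nlinarith
  set X := r / p with hXd
  set Y := -r / (1 - p) with hYd
  -- `w` is the height of the middle value `X + Y` above the kink `t`. Among all heights it gives
  -- the strongest second-order condition on `m`; since `p < 1/2`, `w < ρ`, so the lowest value `2Y`
  -- is cut off.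
  set w := 1 / (1 - p) with hw
  set ρ := 1 / r with hρ
  have hw0 : 0 < w := by positivity
  have hρ0 : 0 < ρ := by positivity
  have hXY : X - Y = ρ := by
    rw [hXd, hYd, hρ]; field_simp; linear_combination hr2
  have hwρ : w < ρ := one_div_lt_one_div_of_lt hr0 hrq
  set t := X + Y - w with ht
  -- The expectation for two equal weights `σ` near `1`, where the value `2 σ Y` contributes
  -- nothing.
  set H : ℝ → ℝ := fun σ =>
    p ^ 2 * (2 * σ * X - t) ^ 3 + 2 * p * (1 - p) * (σ * (X + Y) - t) ^ 3 with hH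
  set H' := 12 * p * (1 - p + r) / (r * (1 - p)) with hH'
  have hHd : HasDerivAt H H' 1 := by
    have h1 : HasDerivAt (fun σ : ℝ => 2 * σ * X - t) (2 * X) 1 := by
      simpa using (((hasDerivAt_id (1 : ℝ)).const_mul 2).mul_const X).sub_const t
    have h2 : HasDerivAt (fun σ : ℝ => σ * (X + Y) - t) (X + Y) 1 := by
      simpa using ((hasDerivAt_id (1 : ℝ)).mul_const (X + Y)).sub_const t
    refine (((h1.fun_pow 3).const_mul (p ^ 2)).fun_add
      ((h2.fun_pow 3).const_mul (2 * p * (1 - p)))).congr_deriv ?_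
    have e1 : 2 * 1 * X - t = w + ρ := by rw [ht, ← hXY]; ring
    have e2 : 1 * (X + Y) - t = w := by rw [ht]; ring
    rw [e1, e2, hXd, hYd, hw, hρ, hH']
    push_cast
    field_simp
    linear_combination 6 * (1 - p) * hr2
  have hK : HasDerivAt (fun y : ℝ => H (y ^ (1 / (2 * m)))) (H' * (1 / (2 * m))) 1 := by
    have h1 : HasDerivAt (fun y : ℝ => y ^ (1 / (2 * m))) (1 / (2 * m)) 1 := by
      simpa using Real.hasDerivAt_rpow_const (x := 1) (p := 1 / (2 * m)) (Or.inl one_ne_zero)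
    have h2 : HasDerivAt H H' ((1 : ℝ) ^ (1 / (2 * m))) := by rwa [Real.one_rpow]
    exact HasDerivAt.comp (1 : ℝ) h2 h1
  set Mf : ℝ → ℝ := fun ε => ((1 + ε) ^ (2 * m) + (1 - ε) ^ (2 * m)) / 2 with hMf
  have hle : nhdsWithin (0 : ℝ) (Set.Ioi 0) ≤ nhds 0 := nhdsWithin_le_nhds
  have hMc : Filter.Tendsto Mf (nhdsWithin 0 (Set.Ioi 0)) (nhds 1) := by
    have h2m : 0 ≤ 2 * m := by positivity
    have hc : Continuous Mf :=
      (((Real.continuous_rpow_const h2m).comp (by fun_prop : Continuous fun ε : ℝ => 1 + ε)).add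
        ((Real.continuous_rpow_const h2m).comp
          (by fun_prop : Continuous fun ε : ℝ => 1 - ε))).div_const 2
    have := (hc.tendsto 0).mono_left hle
    simpa [hMf] using this
  have hlim : Filter.Tendsto (fun ε => (H (Mf ε ^ (1 / (2 * m))) - H 1) / ε ^ 2)
      (nhdsWithin 0 (Set.Ioi 0)) (nhds (m * (2 * m - 1) * (H' * (1 / (2 * m))))) := by
    -- `dslope` rather than a quotient, because `Mf ε = 1` can occur, for instance when `m = 1/2`.
    have h1 := (continuousAt_dslope_same.2 hK.differentiableAt).tendsto.comp hMc
    rw [dslope_same, hK.deriv] at h1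
    refine ((tendsto_rpow_mean_sub_one_div_sq m).mul h1).congr fun ε => ?_
    have := sub_smul_dslope (fun y : ℝ => H (y ^ (1 / (2 * m)))) 1 (Mf ε)
    rw [smul_eq_mul, Real.one_rpow] at this
    rw [← this, Function.comp_apply]
    ring
  -- The `ε²` coefficients for equal weights and for weights `1 ± ε`; their ratio is `(2m - 1)(p +
  -- r)`, which is below `1` exactly when `m < m_*`.
  have hlt : m * (2 * m - 1) * (H' * (1 / (2 * m))) < 6 * p * (1 - p) * w * ρ ^ 2 := by
    have e1 : m * (2 * m - 1) * (H' * (1 / (2 * m))) =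
        6 * p / r ^ 2 * ((2 * m - 1) * (p + r)) := by
      rw [hH']
      field_simp
      linear_combination 12 * (2 * m - 1) * hr2
    have e2 : 6 * p * (1 - p) * w * ρ ^ 2 = 6 * p / r ^ 2 := by
      rw [hw, hρ]; field_simp
    rw [e1, e2]
    exact mul_lt_of_lt_one_right (by positivity) hκ
  have hσ : Filter.Tendsto (fun ε => Mf ε ^ (1 / (2 * m))) (nhdsWithin 0 (Set.Ioi 0))
      (nhds 1) := by
    have h1 : Continuous fun y : ℝ => y ^ (1 / (2 * m)) :=
      Real.continuous_rpow_const (by positivity)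
    have h2 := (h1.tendsto 1).comp hMc
    rwa [Real.one_rpow] at h2
  have ev : ∀ F : ℝ → ℝ, Continuous F → 0 < F 1 →
      ∀ᶠ ε in nhdsWithin 0 (Set.Ioi 0), 0 < F (Mf ε ^ (1 / (2 * m))) := fun F hF h =>
    ((hF.tendsto 1).comp hσ).eventually (lt_mem_nhds h)
  have ev1 := ev (fun σ => 2 * σ * X - t) (by fun_prop) (by
    have : 2 * 1 * X - t = w + ρ := by rw [ht, ← hXY]; ring
    rw [this]; positivity)
  have ev2 := ev (fun σ => σ * (X + Y) - t) (by fun_prop) (by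
    have : 1 * (X + Y) - t = w := by rw [ht]; ring
    rw [this]; positivity)
  have ev3 := ev (fun σ => t - 2 * σ * Y) (by fun_prop) (by
    have : t - 2 * 1 * Y = ρ - w := by rw [ht, ← hXY]; ring
    rw [this]; linarith)
  have ev4 : ∀ᶠ ε : ℝ in nhdsWithin 0 (Set.Ioi 0), 0 < w - ε * ρ := by
    have hc : Continuous fun ε : ℝ => w - ε * ρ := by fun_prop
    exact ((hc.tendsto 0).mono_left hle).eventually (lt_mem_nhds (by simpa using hw0))
  have ev5 : ∀ᶠ ε : ℝ in nhdsWithin 0 (Set.Ioi 0), ε < 1 :=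
    (eventually_lt_nhds one_pos).filter_mono hle
  obtain ⟨ε, h1, h2, h3, h4, h5, h6, hε⟩ := (ev1.and (ev2.and (ev3.and (ev4.and (ev5.and
    ((hlim.eventually (gt_mem_nhds hlt)).and self_mem_nhdsWithin)))))).exists
  have hε0 : 0 < ε := hε
  refine ⟨_, posPart_sub_cube_mem_classF3 t, 1 + ε, 1 - ε, by linarith, by linarith, ?_⟩
  rw [div_lt_iff₀ (by positivity)] at h6
  change bernAvg p (Mf ε ^ (1 / (2 * m))) (bernAvg p (Mf ε ^ (1 / (2 * m))) _) 0 < _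
  set σ := Mf ε ^ (1 / (2 * m))
  have hερ : 0 < ε * ρ := by positivity
  simp only [bernAvg, hX, hY]
  have z1 : 0 + σ * X + σ * X - t = 2 * σ * X - t := by ring
  have z2 : 0 + σ * X + σ * Y - t = σ * (X + Y) - t := by ring
  have z3 : 0 + σ * Y + σ * X - t = σ * (X + Y) - t := by ring
  have z4 : 0 + σ * Y + σ * Y - t = 2 * σ * Y - t := by ring
  have y1 : 0 + (1 + ε) * X + (1 - ε) * X - t = w + ρ := by rw [ht, ← hXY]; ring
  have y2 : 0 + (1 + ε) * X + (1 - ε) * Y - t = w + ε * ρ := by rw [ht, ← hXY]; ring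
  have y3 : 0 + (1 + ε) * Y + (1 - ε) * X - t = w - ε * ρ := by rw [ht, ← hXY]; ring
  have y4 : 0 + (1 + ε) * Y + (1 - ε) * Y - t = w - ρ := by rw [ht, ← hXY]; ring
  rw [z1, z2, z3, z4, y1, y2, y3, y4, max_eq_left h1.le, max_eq_left h2.le,
    max_eq_right (by linarith : 2 * σ * Y - t ≤ 0), max_eq_left (by positivity : 0 ≤ w + ρ),
    max_eq_left (by positivity : 0 ≤ w + ε * ρ), max_eq_left h4.le,
    max_eq_right (by linarith : w - ρ ≤ 0)]
  have hH1 : H 1 = p ^ 2 * (w + ρ) ^ 3 + 2 * p * (1 - p) * w ^ 3 := by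
    rw [hH, ht, ← hXY]; ring
  rw [hH1] at h6
  simp only [hH] at h6
  linarith

theorem exists_pair_of_lt_mStar {p m : ℝ} (hp : p ∈ Set.Ioo (0 : ℝ) 1) (hm0 : 0 < m)
    (hm : m < mStar p) : ∃ f ∈ classF3, ∃ a b : ℝ, 0 ≤ a ∧ 0 ≤ b ∧
      bernAvg p (((a ^ (2 * m) + b ^ (2 * m)) / 2) ^ (1 / (2 * m)))
        (bernAvg p (((a ^ (2 * m) + b ^ (2 * m)) / 2) ^ (1 / (2 * m))) f) 0 <
      bernAvg p a (bernAvg p b f) 0 := by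
  rcases lt_trichotomy p (1 / 2) with h | h | h
  · exact exists_pair_of_lt_half hp.1 h hm0 hm
  · refine exists_pair_of_lt_one hp hm0 ?_
    have h1 := mStar_eq_of_le_half hp.1 h.le
    have e : √(p - p ^ 2) = 1 / 2 := by
      rw [Real.sqrt_eq_iff_mul_self_eq_of_pos (by norm_num), h]; norm_num
    rw [e, h] at h1
    rw [h] at hm
    norm_num at h1
    linarith
  · refine exists_pair_of_lt_one hp hm0 ?_
    rwa [mStar, if_neg (not_le.2 h)] at hm

/-! ### Existence of the variables and conclusion -/

instance stdBernoulli_isProbabilityMeasure (p : ℝ) (hp : p ∈ Set.Ioo (0 : ℝ) 1) :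
    IsProbabilityMeasure (stdBernoulli p hp) := by
  unfold stdBernoulli; infer_instance

theorem exists_isIIDStdBernoulli.{u} (n : ℕ) (p : ℝ) (hp : p ∈ Set.Ioo (0 : ℝ) 1) :
    ∃ (Ω : Type u) (_ : MeasurableSpace Ω) (P : Measure Ω) (_ : IsProbabilityMeasure P)
      (X : Fin n → Ω → ℝ), IsIIDStdBernoulli p hp X P := by
  obtain ⟨Ω, mΩ, P, X, -, hlaw, hind, hP⟩ :=
    -- Lifting the index set places the sample space in the required universe.
    exists_iid (ULift.{u} (Fin n)) (stdBernoulli p hp)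
  exact ⟨Ω, mΩ, P, hP, fun i => X ⟨i⟩,
    ⟨hind.precomp ULift.up_injective, fun i => hlaw ⟨i⟩⟩⟩

theorem mainTheorem2 (p : ℝ) (hp : p ∈ Set.Ioo (0 : ℝ) 1) :
    -- the comparison inequality holds for every `m ≥ m_*(p)`
    (∀ m : ℝ, mStar p ≤ m →
      ∀ f ∈ classF3, ∀ n : ℕ, 1 ≤ n → ∀ c : Fin n → ℝ, (∀ i, 0 ≤ c i) →
      ∀ (Ω : Type*) (_ : MeasurableSpace Ω) (P : Measure Ω) (_ : IsProbabilityMeasure P)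
        (BS : Fin n → Ω → ℝ), IsIIDStdBernoulli p hp BS P →
        ∫ ω, f (∑ i, c i * BS i ω) ∂P ≤ ∫ ω, f (powerMean m c * ∑ i, BS i ω) ∂P) ∧
    -- exactness: it fails for every positive `m < m_*(p)`
    (∀ m : ℝ, 0 < m → m < mStar p →
      ∃ f ∈ classF3, ∃ n : ℕ, 1 ≤ n ∧ ∃ c : Fin n → ℝ, (∀ i, 0 ≤ c i) ∧
      ∃ (Ω : Type*) (_ : MeasurableSpace Ω) (P : Measure Ω) (_ : IsProbabilityMeasure P)
        (BS : Fin n → Ω → ℝ), IsIIDStdBernoulli p hp BS P ∧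
        ∫ ω, f (powerMean m c * ∑ i, BS i ω) ∂P < ∫ ω, f (∑ i, c i * BS i ω) ∂P) := by
  refine ⟨fun m hm f hf n hn c hc Ω _ P _ BS hBS => integral_comp_sum_le hm hf hn hc hBS,
    fun m hm0 hm => ?_⟩
  obtain ⟨f, hf, a, b, ha, hb, hlt⟩ := exists_pair_of_lt_mStar hp hm0 hm
  obtain ⟨Ω, mΩ, P, hP, BS, hBS⟩ := exists_isIIDStdBernoulli 2 p hp
  refine ⟨f, hf, 2, by norm_num, ![a, b], ?_, Ω, mΩ, P, hP, BS, hBS, ?_⟩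
  · intro i; fin_cases i <;> simpa
  · rw [integral_comp_sum_eq_bernAvgs hBS hf.1.continuous,
      integral_comp_mul_sum_eq_bernAvgs hBS hf.1.continuous]
    have e : powerMean m ![a, b] = ((a ^ (2 * m) + b ^ (2 * m)) / 2) ^ (1 / (2 * m)) := by
      simp [powerMean, Fin.sum_univ_two, div_eq_inv_mul]
    have e2 : (Finset.univ.val.map ![a, b] : Multiset ℝ) = a ::ₘ b ::ₘ 0 := by
      rw [Fin.univ_val_map]; simp; rfl
    rw [e, e2, Multiset.replicate_succ, Multiset.replicate_one, bernAvgs_cons, bernAvgs_cons,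
      ← Multiset.cons_zero, bernAvgs_cons, bernAvgs_cons]
    exact hlt
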